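/- Let $S$ be a locally compact Hausdorff space, and let $\bar S$ be a compactification of $S$, i.e. a compact Hausdorff space containing $S$ as a dense subspace. For a topological space $X$, let $\mathfrak R(X)$ be the Boolean algebra of regular open subsets of $X$ (open sets $R$ with $R=\mathrm{int}(\mathrm{clos}\,R)$), with meet $Q\cap R$, join $Q\vee R=\mathrm{int}(\mathrm{clos}(Q\cup R))$ and complement $\neg R=\mathrm{int}(X\setminus R)$. A regular partition of $R\in\mathfrak R(X)$ is a finite family of disjoint elements of $\mathfrak R(X)$ with join $R$. A credence on $\mathfrak R(S)$ is a function $\mu:\mathfrak R(S)\to[0,1]$ with $\mu[S]=1$ and $\mu[R_1\vee\dots\vee R_N]=\sum_n\mu[R_n]$ for every finite family of disjoint $R_1,\dots,R_N\in\mathfrak R(S)$. For $R\in\mathfrak R(S)$ let $\mathcal G(R)=\{g|_R : g\in C_b(S,\mathbb R)\}$, with the uniform norm. An integrator is a family $\{\mathbb I_R\}_{R\in\mathfrak R(S)}$ of bounded linear functionals $\mathbb I_R:\mathcal G(R)\to\mathbb R$ such that $\mathbb I_R[f]\le\mathbb I_R[g]$ whenever $f\le g$ on $R$, and $\mathbb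 I_R[g]=\sum_n\mathbb I_{R_n}[g|_{R_n}]$ for every regular partition $\{R_1,\dots,R_N\}$ of $R$; it is compatible with $\mu$ if $\|\mathbb I_R\|=\mu[R]$ for all $R$. For $g\in C_b(S,\mathbb R)$ write $\mathbb I_R[g]$ for $\mathbb I_R[g|_R]$. A Borel measure $\nu$ on $\bar S$ is normal if, for every Borel set $B$, $\nu(B)$ is the supremum of $\nu(C)$ over closed $C\subseteq B$ and the infimum of $\nu(O)$ over open $O\supseteq B$. A liminal density structure subordinate to $\nu$ is a family $\{\phi_R\}_{R\in\mathfrak R(\bar S)}$ of classes $\phi_R\in L^1(\partial R,\nu;[0,1])$ such that, for every regular partition $\{R_1,\dots,R_N\}$ of $\bar S$, $\phi_{R_1}+\dots+\phi_{R_N}=1$ $\nu$-almost everywhere on $\partial R_1\cup\dots\cup\partial R_N$, where each $\phi_{R_n}$ is extended by $0$ off $\partial R_n$. Theorem. Let $\mu$ be a credence on $\mathfrak R(S)$. There is a unique integrator $\{\mathbb I_R\}_{R\in\mathfrak R(S)}$ compatible with $\mu$, and for every $R\in\mathfrak R(S)$ there is a unique $\bar R\in\mathfrak R(\bar S)$ with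 $\bar R\cap S=R$. There are a unique normal Borel measure $\bar\nu$ on $\bar S$ and a unique liminal density structure $\{\bar\phi_R\}_{R\in\mathfrak R(\bar S)}$ subordinate to $\bar\nu$ such that, for every $R\in\mathfrak R(S)$, $$\mu[R]=\bar\nu(\bar R)+\int_{\partial\bar R}\bar\phi_{\bar R}\,d\bar\nu ,$$ and $\bar\nu$ is a probability measure. Furthermore, for every $R\in\mathfrak R(S)$ and every $f\in C(S,\mathbb R)$ that has a continuous extension $\bar f\in C(\bar S,\mathbb R)$, $$\mathbb I_R[f]=\int_{\bar R}\bar f\,d\bar\nu+\int_{\partial\bar R}\bar f\,\bar\phi_{\bar R}\,d\bar\nu .$$ -/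

import Mathlib

open MeasureTheory TopologicalSpace
open scoped BoundedContinuousFunction

/-- The Boolean algebra of regular open subsets of a topological space: the Heyting-regular
elements of the frame of open sets.  `RegOpen.isRegular_iff`, `RegOpen.set_compl`, `RegOpen.set_inf`,
`RegOpen.set_finset_sup` and `RegOpen.disjoint_iff` below check that regularity means
`U = int (clos U)`, and that the operations are the usual ones on regular open sets. -/
abbrev RegOpen (S : Type*) [TopologicalSpace S] : Type _ := Heyting.Regular (Opens S)

/-- The underlying subset of a regular open set. -/
def RegOpen.set {S : Type*} [TopologicalSpace S] (R : RegOpen S) : Set S :=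
  ((R : Opens S) : Set S)

theorem RegOpen.coe_compl_compl_eq {S : Type*} [TopologicalSpace S] (U : Opens S) :
    ((Uᶜᶜ : Opens S) : Set S) = interior (closure (U : Set S)) := by
  rw [Opens.coe_compl_eq_interior_compl, Opens.coe_compl_eq_interior_compl, interior_compl]
  simp

theorem RegOpen.isRegular_iff {S : Type*} [TopologicalSpace S] (U : Opens S) :
    Heyting.IsRegular U ↔ (U : Set S) = interior (closure (U : Set S)) := by
  rw [← RegOpen.coe_compl_compl_eq, SetLike.coe_set_eq]
  exact eq_comm

theorem RegOpen.ext_set {S : Type*} [TopologicalSpace S] {Q R : RegOpen S}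
    (h : Q.set = R.set) : Q = R :=
  Heyting.Regular.coe_injective (SetLike.coe_injective h)

theorem RegOpen.isOpen_set {S : Type*} [TopologicalSpace S] (R : RegOpen S) :
    IsOpen R.set := (R : Opens S).isOpen

theorem RegOpen.set_top {S : Type*} [TopologicalSpace S] : (⊤ : RegOpen S).set = Set.univ := rfl

theorem RegOpen.set_bot {S : Type*} [TopologicalSpace S] : (⊥ : RegOpen S).set = ∅ := rfl

theorem RegOpen.set_inf {S : Type*} [TopologicalSpace S] (Q R : RegOpen S) :
    (Q ⊓ R).set = Q.set ∩ R.set := rfl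

theorem RegOpen.set_compl {S : Type*} [TopologicalSpace S] (R : RegOpen S) :
    (Rᶜ).set = interior (R.set)ᶜ := Opens.coe_compl_eq_interior_compl

theorem RegOpen.set_sup {S : Type*} [TopologicalSpace S] (Q R : RegOpen S) :
    (Q ⊔ R).set = interior (closure (Q.set ∪ R.set)) :=
  RegOpen.coe_compl_compl_eq ((Q : Opens S) ⊔ (R : Opens S))

theorem RegOpen.disjoint_iff {S : Type*} [TopologicalSpace S] (Q R : RegOpen S) :
    Disjoint Q R ↔ Disjoint Q.set R.set := by
  rw [_root_.disjoint_iff, Set.disjoint_iff_inter_eq_empty, ← RegOpen.set_inf,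
    ← RegOpen.set_bot]
  exact ⟨fun h => congrArg RegOpen.set h, fun h => RegOpen.ext_set h⟩

theorem RegOpen.set_finset_sup {S : Type*} [TopologicalSpace S] {N : ℕ}
    (B : Fin N → RegOpen S) :
    (Finset.univ.sup B).set = interior (closure (⋃ n, (B n).set)) := by
  have h : Finset.univ.sup B = Heyting.Regular.toRegular (⨆ n, (B n : Opens S)) := by
    have h2 := (Heyting.Regular.gi (α := Opens S)).gc
    apply le_antisymm
    · refine Finset.sup_le fun n _ => ?_
      have h3 : (B n : Opens S) ≤ ⨆ n, (B n : Opens S) := le_iSup (fun n => (B n : Opens S)) n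
      exact Heyting.Regular.coe_le_coe.1 (h3.trans (h2.le_u_l _))
    · refine h2.l_le (iSup_le fun n => ?_)
      exact Heyting.Regular.coe_le_coe.2 (Finset.le_sup (Finset.mem_univ n))
  rw [h]
  refine (RegOpen.coe_compl_compl_eq (⨆ n, (B n : Opens S))).trans ?_
  rw [Opens.coe_iSup]
  rfl

/-- `B 0, …, B (N-1)` is a regular open partition of `R`: the members are disjoint and their
join (in the algebra of regular open sets) is `R`. -/
def IsRegPartition {S : Type*} [TopologicalSpace S] {N : ℕ} (R : RegOpen S)
    (B : Fin N → RegOpen S) : Prop :=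
  Pairwise (fun i j => Disjoint (B i) (B j)) ∧ Finset.univ.sup B = R

/-- A credence on the Boolean algebra of all regular open subsets of `S`. -/
structure Credence (S : Type*) [TopologicalSpace S] where
  toFun : RegOpen S → ℝ
  mem_Icc : ∀ R, toFun R ∈ Set.Icc (0 : ℝ) 1
  top_eq : toFun ⊤ = 1
  additive : ∀ (N : ℕ) (B : Fin N → RegOpen S), Pairwise (fun i j => Disjoint (B i) (B j)) →
    toFun (Finset.univ.sup B) = ∑ n, toFun (B n)

/-- Restriction of bounded continuous functions to a subset. -/
def restrictCb {S : Type*} [TopologicalSpace S] (B : Set S) : (S →ᵇ ℝ) →ₗ[ℝ] (B →ᵇ ℝ) where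
  toFun g := g.compContinuous ⟨Subtype.val, continuous_subtype_val⟩
  map_add' _ _ := rfl
  map_smul' _ _ := rfl

/-- The space of restrictions to `B` of bounded continuous functions on `S`, as a linear
subspace of the bounded continuous functions on `B`, with the uniform norm. -/
abbrev RestrSpace {S : Type*} [TopologicalSpace S] (B : Set S) : Submodule ℝ (B →ᵇ ℝ) :=
  LinearMap.range (restrictCb B)

/-- The restriction of `g` to `B`, as an element of `RestrSpace B`. -/
def restrTo {S : Type*} [TopologicalSpace S] (B : Set S) (g : S →ᵇ ℝ) :
    RestrSpace B :=
  ⟨restrictCb B g, g, rfl⟩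

/-- An integrator on the algebra of all regular open subsets of `S` (for this full algebra every
continuous function is comeasurable). -/
structure Integrator (S : Type*) [TopologicalSpace S] where
  functional : (R : RegOpen S) → RestrSpace R.set →ₗ[ℝ] ℝ
  bounded : ∀ R : RegOpen S, ∃ C : ℝ, ∀ g, |functional R g| ≤ C * ‖g‖
  mono : ∀ (R : RegOpen S) (f g : RestrSpace R.set),
    (∀ b, (f : R.set →ᵇ ℝ) b ≤ (g : R.set →ᵇ ℝ) b) → functional R f ≤ functional R g
  partition : ∀ (R : RegOpen S) (N : ℕ) (B : Fin N → RegOpen S), IsRegPartition R B →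
    ∀ g : S →ᵇ ℝ, functional R (restrTo R.set g) = ∑ n, functional (B n) (restrTo (B n).set g)

/-- `I` is compatible with `μ`: for every regular open `R`, the operator norm of the functional
`I_R` (the least constant bounding it, for the uniform norm on `R`) is `μ[R]`. -/
def Integrator.IsCompatible {S : Type*} [TopologicalSpace S] (I : Integrator S)
    (μ : Credence S) : Prop :=
  ∀ R : RegOpen S,
    IsLeast {C : ℝ | 0 ≤ C ∧ ∀ g : RestrSpace R.set, |I.functional R g| ≤ C * ‖g‖} (μ.toFun R)

/-- The integral of (the restriction to `R` of) `g` over `R`. -/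
def Integrator.int {S : Type*} [TopologicalSpace S] (I : Integrator S)
    (R : RegOpen S) (g : S →ᵇ ℝ) : ℝ :=
  I.functional R (restrTo R.set g)

/-- Normality of a Borel measure: every measurable set is approximated in measure from within by
closed sets and from outside by open sets. -/
def IsNormalMeasure {X : Type*} [TopologicalSpace X] [MeasurableSpace X] (ν : Measure X) : Prop :=
  ν.InnerRegularWRT IsClosed MeasurableSet ∧ ν.OuterRegular

/-- A liminal density structure subordinate to `ν`.  Only the `ν`-a.e. class of `density R` on the
boundary of `R` is meaningful; in the sum each density is extended by zero off that boundary. -/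
structure LiminalDensity {X : Type*} [TopologicalSpace X] [MeasurableSpace X]
    (ν : Measure X) where
  density : RegOpen X → X → ℝ
  integrable : ∀ R : RegOpen X, IntegrableOn (density R) (frontier R.set) ν
  mem_Icc : ∀ R : RegOpen X,
    ∀ᵐ x ∂(ν.restrict (frontier R.set)), density R x ∈ Set.Icc (0 : ℝ) 1
  partition : ∀ (N : ℕ) (B : Fin N → RegOpen X), IsRegPartition ⊤ B →
    ∀ᵐ x ∂(ν.restrict (⋃ n, frontier (B n).set)),
      ∑ n, (frontier (B n).set).indicator (density (B n)) x = 1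

/-- `Rbar` is an extension of `R` along `ι : S → Sbar`: the trace of `Rbar` on `S` is `R`. -/
def IsRegExtension {S Sbar : Type*} [TopologicalSpace S] [TopologicalSpace Sbar] (ι : S → Sbar)
    (R : RegOpen S) (Rbar : RegOpen Sbar) : Prop :=
  ι ⁻¹' Rbar.set = R.set

/-- `μ[R] = ν(R̄) + ∫_{∂R̄} φ_{R̄} dν` for every regular open `R` and its extension `R̄`. -/
def Represents {S Sbar : Type*} [TopologicalSpace S] [TopologicalSpace Sbar]
    [MeasurableSpace Sbar] (ι : S → Sbar) (ν : Measure Sbar) (φ : LiminalDensity ν)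
    (μ : Credence S) : Prop :=
  ∀ (R : RegOpen S) (Rbar : RegOpen Sbar), IsRegExtension ι R Rbar →
    μ.toFun R = ν.real Rbar.set + ∫ x in frontier Rbar.set, φ.density Rbar x ∂ν

/-! ### The algebra of regular open sets -/

namespace RegOpen

section Basic

variable {S : Type*} [TopologicalSpace S]

/-! A bounded continuous function is, up to ε, constant on each piece of a finite regular partition.
So a functional additive over regular partitions and controlled by the oscillation of `g` is
determined by its mass function; this is `Integrates.unique`, and it yields both uniqueness
statements. A compatible integrator exists as a limit of Riemann sums along an ultrafilter of
partitions (`exists_integral`).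

Since `S` is dense, `trace` is a bijection between the regular open algebras of `Sbar` and `S`
respecting their operations. The integrator thus gives positive functionals `Λ R` on `C(Sbar, ℝ)`,
additive in `R` and depending only on values on `R`. By Riesz they are measures `m R ≤ m ⊤`. The
density of `m R` against `ν = m ⊤` lies in [0,1], vanishes off the closure of `R` and, by the same
fact for `Rᶜ`, equals 1 on `R`. Only its values on the boundary are free: they are the liminal
density (`exists_liminalDensity`).

Conversely, integrating `f` against the weight `1_R + φ_R 1_∂R` is controlled by the oscillation of
`f`, so the masses determine these integrals, hence `ν` and then `φ`. -/

theorem set_subset_iff {Q R : RegOpen S} : Q.set ⊆ R.set ↔ Q ≤ R := Iff.rfl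

theorem interior_closure_set (R : RegOpen S) : interior (closure R.set) = R.set :=
  ((isRegular_iff (R : Opens S)).1 R.2).symm

theorem closure_set_compl (R : RegOpen S) : closure (Rᶜ).set = (R.set)ᶜ := by
  rw [set_compl, interior_compl, closure_compl, interior_closure_set]

theorem compl_frontier_subset (R : RegOpen S) :
    (frontier R.set)ᶜ ⊆ R.set ∪ (closure R.set)ᶜ := by
  intro x hx
  by_cases h : x ∈ closure R.set
  · left
    by_contra h'
    exact hx ⟨h, by rwa [R.isOpen_set.interior_eq]⟩
  · exact Or.inr h

theorem disjoint_closure {Q R : RegOpen S} (h : Disjoint Q R) :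
    Disjoint Q.set (closure R.set) :=
  ((disjoint_iff Q R).1 h).closure_right Q.isOpen_set

/-- The regular open hull of an open set. -/
def hull (U : Opens S) : RegOpen S := Heyting.Regular.toRegular U

theorem set_hull (U : Opens S) : (hull U).set = interior (closure (U : Set S)) :=
  coe_compl_compl_eq U

theorem subset_hull (U : Opens S) : (U : Set S) ⊆ (hull U).set := by
  rw [set_hull]
  exact U.isOpen.subset_interior_closure

theorem isRegPartition_pair {a b : RegOpen S} (h : Disjoint a b) :
    IsRegPartition (a ⊔ b) ![a, b] := by
  refine ⟨fun i j hij => ?_, ?_⟩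
  · fin_cases i <;> fin_cases j <;> simp_all [disjoint_comm]
  · simp [Fin.univ_succ]

theorem isRegPartition_triple {a b : RegOpen S} (h : Disjoint a b) :
    IsRegPartition ⊤ ![a, b, (a ⊔ b)ᶜ] := by
  have h1 : Disjoint a (a ⊔ b)ᶜ := disjoint_compl_right.mono_left le_sup_left
  have h2 : Disjoint b (a ⊔ b)ᶜ := disjoint_compl_right.mono_left le_sup_right
  refine ⟨fun i j hij => ?_, ?_⟩
  · fin_cases i <;> fin_cases j <;> first | exact absurd rfl hij | skip
    exacts [h, h1, h.symm, h2, h1.symm, h2.symm]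
  · have : Finset.univ.sup ![a, b, (a ⊔ b)ᶜ] = (a ⊔ b) ⊔ (a ⊔ b)ᶜ := by
      simp only [Fin.univ_succ]
      simp [sup_assoc]
    rw [this, sup_compl_eq_top]

/-- A function on the algebra of regular open sets that is additive on disjoint pairs. -/
def IsAdditive (Φ : RegOpen S → ℝ) : Prop :=
  ∀ a b, Disjoint a b → Φ (a ⊔ b) = Φ a + Φ b

theorem IsAdditive.map_bot {Φ : RegOpen S → ℝ} (h : IsAdditive Φ) : Φ ⊥ = 0 := by
  simpa using h ⊥ ⊥ disjoint_bot_left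

theorem IsAdditive.map_finset_sup {Φ : RegOpen S → ℝ} (h : IsAdditive Φ) {κ : Type*}
    (s : Finset κ) (B : κ → RegOpen S) (hB : (s : Set κ).PairwiseDisjoint B) :
    Φ (s.sup B) = ∑ i ∈ s, Φ (B i) := by
  classical
  induction s using Finset.induction_on with
  | empty => simpa using h.map_bot
  | insert i s hi ih =>
    rw [Finset.sup_insert, Finset.sum_insert hi, h, ih]
    · exact hB.subset (by simp)
    · refine Finset.disjoint_sup_right.2 fun j hj => hB (by simp) (by simp [hj]) ?_
      rintro rfl
      exact hi hj

/-- `Φ` integrates `g` with respect to `m`, up to the oscillation of `g`. -/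
def Integrates (m : RegOpen S → ℝ) (g : S → ℝ) (Φ : RegOpen S → ℝ) : Prop :=
  IsAdditive Φ ∧ ∀ R c ε, (∀ x ∈ R.set, |g x - c| ≤ ε) → |Φ R - c * m R| ≤ ε * m R

theorem Integrates.unique {m : RegOpen S → ℝ} (hm : IsAdditive m) {g : S →ᵇ ℝ}
    {Φ Ψ : RegOpen S → ℝ} (hΦ : Integrates m g Φ) (hΨ : Integrates m g Ψ) (R : RegOpen S) :
    Φ R = Ψ R := by
  classical
  have key : ∀ ε > 0, |Φ R - Ψ R| ≤ 2 * ε * m R := by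
    intro ε hε
    obtain ⟨t, ht, hcov⟩ := Metric.totallyBounded_iff.1
      (g.isBounded_range.isCompact_closure.totallyBounded.subset subset_closure) ε hε
    lift t to Finset ℝ using ht
    let C : ℝ → RegOpen S := fun c => hull ⟨g ⁻¹' Metric.ball c ε, Metric.isOpen_ball.preimage
      g.continuous⟩
    -- The hull may enlarge the preimage of the ball, but stays inside the closed preimage of the
    -- closed ball.
    have hC : ∀ c, ∀ x ∈ (C c).set, |g x - c| ≤ ε := by
      intro c x hx
      rw [set_hull] at hx
      have h1 : x ∈ g ⁻¹' Metric.closedBall c ε :=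
        closure_minimal (Set.preimage_mono Metric.ball_subset_closedBall)
          (Metric.isClosed_closedBall.preimage g.continuous) (interior_subset hx)
      simpa [Real.dist_eq] using h1
    -- Quantifying over all `Q` below the join lets the induction split `Q` into `Q ⊓ C c` and `Q \
    -- C c`, so the overlapping cover never has to be made disjoint.
    have claim : ∀ s : Finset ℝ, ∀ Q ≤ s.sup C, |Φ Q - Ψ Q| ≤ 2 * ε * m Q := by
      intro s
      induction s using Finset.induction_on with
      | empty =>
        intro Q hQ
        obtain rfl : Q = ⊥ := by simpa using hQ
        simp [hΦ.1.map_bot, hΨ.1.map_bot, hm.map_bot]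
      | insert c s _ ih =>
        intro Q hQ
        have hd : Disjoint (Q ⊓ C c) (Q \ C c) := disjoint_inf_sdiff
        have h1 := ih (Q \ C c) (by rw [sdiff_le_iff]; simpa using hQ)
        have hb : ∀ x ∈ (Q ⊓ C c).set, |g x - c| ≤ ε := fun x hx => hC c x hx.2
        have h2 := hΦ.2 _ c ε hb
        have h3 := hΨ.2 _ c ε hb
        have hQ' : Q ⊓ C c ⊔ Q \ C c = Q := sup_inf_sdiff Q (C c)
        have h4 := hΦ.1 _ _ hd
        have h5 := hΨ.1 _ _ hd
        have h6 := hm _ _ hd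
        rw [hQ'] at h4 h5 h6
        rw [h4, h5, h6]
        rw [abs_le] at *
        constructor <;> linarith
    refine claim t R (le_trans le_top (le_of_eq ?_))
    refine (top_le_iff.1 fun x _ => ?_).symm
    obtain ⟨c, hc, hx⟩ := Set.mem_iUnion₂.1 (hcov ⟨x, rfl⟩)
    exact set_subset_iff.2 (Finset.le_sup (f := C) hc) (subset_hull _ hx)
  by_contra hne
  have hd : 0 < |Φ R - Ψ R| := abs_pos.2 (sub_ne_zero.2 hne)
  have hM : 0 < |m R| + 1 := by positivity
  have h := key (|Φ R - Ψ R| / (2 * (|m R| + 1))) (by positivity)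
  have h2 : 2 * (|Φ R - Ψ R| / (2 * (|m R| + 1))) * m R
      = |Φ R - Ψ R| * (m R / (|m R| + 1)) := by field_simp
  have h3 : m R / (|m R| + 1) < 1 := by
    rw [div_lt_one hM]
    linarith [le_abs_self (m R)]
  rw [h2] at h
  nlinarith

end Basic

/-! ### Restriction of regular open sets to a dense subspace -/

section Trace

variable {S X : Type*} [TopologicalSpace S] [TopologicalSpace X] {ι : S → X}

/-- If the traces of open sets `W` and `U` are disjoint, the open set `W ∩ U` misses a dense set and
is empty. This is what makes `trace` respect complements. -/
theorem interior_compl_preimage (hι : IsDenseEmbedding ι) {U : Set X} (hU : IsOpen U) :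
    interior (ι ⁻¹' U)ᶜ = ι ⁻¹' interior Uᶜ := by
  refine subset_antisymm (fun s hs => ?_) ?_
  · obtain ⟨V, hVs, hV, hsV⟩ := mem_interior.1 hs
    obtain ⟨W, hW, rfl⟩ := hι.isInducing.isOpen_iff.1 hV
    refine mem_interior.2 ⟨W, fun x hxW hxU => ?_, hW, hsV⟩
    obtain ⟨y, hy⟩ := hι.dense.exists_mem_open (hW.inter hU) ⟨x, hxW, hxU⟩
    exact hVs hy.1 hy.2
  · exact preimage_interior_subset_interior_preimage hι.continuous

theorem comap_compl (hι : IsDenseEmbedding ι) (U : Opens X) :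
    Opens.comap ⟨ι, hι.continuous⟩ Uᶜ = (Opens.comap ⟨ι, hι.continuous⟩ U)ᶜ := by
  apply SetLike.coe_injective
  simp only [Opens.coe_comap, Opens.coe_compl_eq_interior_compl]
  exact (interior_compl_preimage hι U.isOpen).symm

/-- The trace of a regular open set on a dense subspace. -/
def trace (hι : IsDenseEmbedding ι) (Q : RegOpen X) : RegOpen S :=
  ⟨Opens.comap ⟨ι, hι.continuous⟩ (Q : Opens X), by
    rw [Heyting.IsRegular, ← comap_compl hι, ← comap_compl hι]
    exact congrArg _ Q.2.eq⟩

variable (hι : IsDenseEmbedding ι)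

theorem set_trace (Q : RegOpen X) : (trace hι Q).set = ι ⁻¹' Q.set := rfl

theorem isRegExtension_iff {R : RegOpen S} {Q : RegOpen X} :
    IsRegExtension ι R Q ↔ trace hι Q = R :=
  ⟨fun h => ext_set h, fun h => h ▸ rfl⟩

theorem trace_top : trace hι ⊤ = ⊤ := rfl

theorem trace_compl (Q : RegOpen X) : trace hι Qᶜ = (trace hι Q)ᶜ :=
  Heyting.Regular.coe_injective (comap_compl hι _)

theorem trace_inf (Q R : RegOpen X) : trace hι (Q ⊓ R) = trace hι Q ⊓ trace hι R := rfl

theorem trace_sup (Q R : RegOpen X) : trace hι (Q ⊔ R) = trace hι Q ⊔ trace hι R := by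
  rw [← compl_inj_iff, ← trace_compl, compl_sup, compl_sup, ← trace_compl, ← trace_compl]
  exact trace_inf hι Qᶜ Rᶜ

theorem disjoint_trace {Q R : RegOpen X} (h : Disjoint Q R) :
    Disjoint (trace hι Q) (trace hι R) :=
  (disjoint_iff _ _).2 (((disjoint_iff Q R).1 h).preimage ι)

theorem IsAdditive.comp_trace {Φ : RegOpen S → ℝ} (h : IsAdditive Φ) :
    IsAdditive fun Q => Φ (trace hι Q) := fun a b hab => by
  simpa only [trace_sup] using h _ _ (disjoint_trace hι hab)

theorem closure_image_trace (Q : RegOpen X) : closure (ι '' (trace hι Q).set) = closure Q.set := by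
  rw [set_trace, Set.image_preimage_eq_inter_range]
  exact subset_antisymm (closure_mono Set.inter_subset_left)
    (closure_minimal (hι.dense.open_subset_closure_inter Q.isOpen_set) isClosed_closure)

theorem trace_injective (hι : IsDenseEmbedding ι) : Function.Injective (trace hι) := fun Q R h => by
  apply ext_set
  rw [← interior_closure_set Q, ← interior_closure_set R, ← closure_image_trace hι,
    ← closure_image_trace hι, h]

/-- Any open `W` with trace `R` will do after taking its hull: the trace commutes with double
complement, and `R` is regular. -/
theorem trace_surjective (hι : IsDenseEmbedding ι) : Function.Surjective (trace hι) := fun R => by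
  obtain ⟨W, hW, hWR⟩ := hι.isInducing.isOpen_iff.1 R.isOpen_set
  refine ⟨hull ⟨W, hW⟩, ?_⟩
  apply Heyting.Regular.coe_injective
  have h : (R : Opens S) = Opens.comap ⟨ι, hι.continuous⟩ ⟨W, hW⟩ :=
    SetLike.coe_injective hWR.symm
  change Opens.comap ⟨ι, hι.continuous⟩ (⟨W, hW⟩ : Opens X)ᶜᶜ = R
  rw [comap_compl hι, comap_compl hι, ← h]
  exact R.2.eq

theorem existsUnique_isRegExtension (hι : IsDenseEmbedding ι) (R : RegOpen S) :
    ∃! Q : RegOpen X, IsRegExtension ι R Q := by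
  obtain ⟨Q, hQ⟩ := trace_surjective hι R
  exact ⟨Q, (isRegExtension_iff hι).2 hQ, fun Q' h =>
    trace_injective hι (((isRegExtension_iff hι).1 h).trans hQ.symm)⟩

end Trace

end RegOpen

theorem Credence.isAdditive {S : Type*} [TopologicalSpace S] (μ : Credence S) :
    RegOpen.IsAdditive μ.toFun := fun a b h => by
  have h1 := RegOpen.isRegPartition_pair h
  rw [← h1.2, μ.additive 2 _ h1.1]
  simp [Fin.sum_univ_two]

/-! ### The integrator of a credence -/

namespace Credence

open Filter Topology

variable {S : Type*} [TopologicalSpace S] (μ : Credence S)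

theorem nonneg (R : RegOpen S) : 0 ≤ μ.toFun R := (μ.mem_Icc R).1

include μ in
theorem nonempty : Nonempty S := by
  by_contra h
  rw [not_nonempty_iff] at h
  have h1 : (⊤ : RegOpen S) = ⊥ := RegOpen.ext_set (Set.eq_empty_of_isEmpty _)
  have h2 := μ.top_eq
  rw [h1, μ.isAdditive.map_bot] at h2
  exact zero_ne_one h2

theorem sum_inf_parts (R : RegOpen S) (P : Finpartition (⊤ : RegOpen S)) :
    ∑ q ∈ P.parts, μ.toFun (R ⊓ q) = μ.toFun R := by
  rw [← μ.isAdditive.map_finset_sup P.parts (fun q => R ⊓ q)]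
  · congr 1
    have h := Finset.sup_inf_distrib_left P.parts id R
    rw [P.sup_parts, inf_top_eq] at h
    exact h.symm
  · exact P.disjoint.mono fun q => inf_le_right

/-- The Riemann sum of `g` over `R` along a finite partition, for a choice of tags. -/
noncomputable def riemannSum (t : RegOpen S → S) (P : Finpartition (⊤ : RegOpen S))
    (R : RegOpen S) : (S →ᵇ ℝ) →ₗ[ℝ] ℝ where
  toFun g := ∑ q ∈ P.parts, μ.toFun (R ⊓ q) * g (t q)
  map_add' f g := by simp [mul_add, Finset.sum_add_distrib]
  map_smul' c g := by simp [Finset.mul_sum, mul_left_comm]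

theorem riemannSum_apply (t : RegOpen S → S) (P : Finpartition (⊤ : RegOpen S))
    (R : RegOpen S) (g : S →ᵇ ℝ) :
    μ.riemannSum t P R g = ∑ q ∈ P.parts, μ.toFun (R ⊓ q) * g (t q) := rfl

theorem abs_riemannSum_le (t : RegOpen S → S) (P : Finpartition (⊤ : RegOpen S))
    (R : RegOpen S) (g : S →ᵇ ℝ) : |μ.riemannSum t P R g| ≤ μ.toFun R * ‖g‖ := by
  rw [riemannSum_apply, ← μ.sum_inf_parts R P, Finset.sum_mul]
  refine (Finset.abs_sum_le_sum_abs _ _).trans (Finset.sum_le_sum fun q _ => ?_)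
  rw [abs_mul, abs_of_nonneg (μ.nonneg _)]
  exact mul_le_mul_of_nonneg_left (g.norm_coe_le_norm _) (μ.nonneg _)

theorem isAdditive_riemannSum (t : RegOpen S → S) (P : Finpartition (⊤ : RegOpen S))
    (g : S →ᵇ ℝ) : RegOpen.IsAdditive fun R => μ.riemannSum t P R g := fun a b h => by
  simp only [riemannSum_apply, ← Finset.sum_add_distrib, ← add_mul]
  refine Finset.sum_congr rfl fun q _ => ?_
  have hq : (a ⊔ b) ⊓ q = a ⊓ q ⊔ b ⊓ q := inf_sup_right a b q
  have hd : Disjoint (a ⊓ q) (b ⊓ q) := h.mono inf_le_left inf_le_left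
  rw [hq, μ.isAdditive _ _ hd]

/-- Finer partitions are smaller, so `atBot` is the refinement filter. The threshold is `{R, Rᶜ}`,
with `⊥` erased in case `R` is trivial. -/
theorem eventually_le_or_disjoint [DecidableEq (RegOpen S)] (R : RegOpen S) :
    ∀ᶠ P : Finpartition (⊤ : RegOpen S) in atBot, ∀ q ∈ P.parts, q ≤ R ∨ R ⊓ q = ⊥ := by
  have hs : ({R, Rᶜ} : Finset (RegOpen S)).SupIndep id := by
    refine Finset.supIndep_iff_pairwiseDisjoint.2 fun a ha b hb hab => ?_
    have h : Disjoint R Rᶜ := disjoint_compl_right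
    simp only [Finset.coe_insert, Finset.coe_singleton, Set.mem_insert_iff,
      Set.mem_singleton_iff] at ha hb
    rcases ha with rfl | rfl <;> rcases hb with rfl | rfl
    exacts [absurd rfl hab, h, h.symm, absurd rfl hab]
  filter_upwards [eventually_le_atBot (Finpartition.ofErase {R, Rᶜ} hs (by simp))]
    with P hP q hq
  obtain ⟨c, hc, hqc⟩ := hP hq
  simp only [Finpartition.ofErase, Finset.mem_erase, Finset.mem_insert,
    Finset.mem_singleton] at hc
  rcases hc.2 with rfl | rfl
  · exact Or.inl hqc
  · exact Or.inr ((disjoint_compl_right.mono_right hqc).eq_bot)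

/-- Integration of bounded continuous functions against a credence. -/
theorem exists_integral : ∃ J : RegOpen S → (S →ᵇ ℝ) →ₗ[ℝ] ℝ,
    (∀ g, RegOpen.IsAdditive fun R => J R g) ∧ (∀ R, J R 1 = μ.toFun R) ∧
    ∀ R f g, (∀ x ∈ R.set, f x ≤ g x) → J R f ≤ J R g := by
  classical
  have := μ.nonempty
  -- The tag of `⊥` is a junk value; `⊥` is never a part of a `Finpartition`.
  let t : RegOpen S → S := fun q => Classical.epsilon (· ∈ q.set)
  have ht : ∀ q : RegOpen S, q ≠ ⊥ → t q ∈ q.set := fun q hq => by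
    refine Classical.epsilon_spec (p := (· ∈ q.set)) (Set.nonempty_iff_ne_empty.2 fun h => hq ?_)
    exact RegOpen.ext_set h
  -- Along an ultrafilter the bounded Riemann sums converge for all `R` and `g` at once, with no
  -- Cauchy estimate.
  obtain ⟨U, hU⟩ := Ultrafilter.exists_le (atBot : Filter (Finpartition (⊤ : RegOpen S)))
  have hex : ∀ R g, ∃ L, Tendsto (fun P => μ.riemannSum t P R g) U (𝓝 L) := fun R g => by
    obtain ⟨L, -, hL⟩ := (isCompact_closedBall (0 : ℝ) (μ.toFun R * ‖g‖)).ultrafilter_le_nhds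
      (U.map fun P => μ.riemannSum t P R g) (by
        refine le_principal_iff.2 (Ultrafilter.mem_map.2 (Filter.Eventually.of_forall fun P => ?_))
        simpa using μ.abs_riemannSum_le t P R g)
    exact ⟨L, hL⟩
  choose L hL using hex
  refine ⟨fun R => ⟨⟨L R, fun f g => ?_⟩, fun c g => ?_⟩, fun g a b hab => ?_, fun R => ?_,
    fun R f g hfg => ?_⟩
  · refine tendsto_nhds_unique (hL R (f + g)) ?_
    simpa only [map_add] using (hL R f).add (hL R g)
  · refine tendsto_nhds_unique (hL R (c • g)) ?_
    simpa only [map_smul, RingHom.id_apply] using (hL R g).const_smul c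
  · refine tendsto_nhds_unique (hL (a ⊔ b) g) ?_
    exact ((hL a g).add (hL b g)).congr fun P =>
      (μ.isAdditive_riemannSum t P g a b hab).symm
  · refine tendsto_nhds_unique (hL R 1) ?_
    simp only [riemannSum_apply, BoundedContinuousFunction.coe_one, Pi.one_apply, mul_one,
      sum_inf_parts]
    exact tendsto_const_nhds
  · refine le_of_tendsto_of_tendsto (hL R f) (hL R g) ?_
    -- Once `P` refines `{R, Rᶜ}`, every cell either has its tag in `R` or carries no mass.
    filter_upwards [hU (eventually_le_or_disjoint R)] with P hP
    refine Finset.sum_le_sum fun q hq => ?_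
    rcases hP q hq with h | h
    · exact mul_le_mul_of_nonneg_left
        (hfg _ (RegOpen.set_subset_iff.2 h (ht q (P.ne_bot hq)))) (μ.nonneg _)
    · simp [h, μ.isAdditive.map_bot]

end Credence

/-! ### Positivity and compatibility of integrators -/

namespace Integrator

variable {S : Type*} [TopologicalSpace S]

theorem int_mono (I : Integrator S) (R : RegOpen S) {f g : S →ᵇ ℝ}
    (h : ∀ x ∈ R.set, f x ≤ g x) : I.int R f ≤ I.int R g :=
  I.mono R _ _ fun b => h b b.2

theorem restrTo_add (B : Set S) (f g : S →ᵇ ℝ) : restrTo B (f + g) = restrTo B f + restrTo B g :=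
  rfl

theorem restrTo_smul (B : Set S) (c : ℝ) (g : S →ᵇ ℝ) : restrTo B (c • g) = c • restrTo B g :=
  rfl

theorem int_add (I : Integrator S) (R : RegOpen S) (f g : S →ᵇ ℝ) :
    I.int R (f + g) = I.int R f + I.int R g :=
  map_add (I.functional R) (restrTo R.set f) (restrTo R.set g)

theorem int_smul (I : Integrator S) (R : RegOpen S) (c : ℝ) (g : S →ᵇ ℝ) :
    I.int R (c • g) = c * I.int R g :=
  map_smul (I.functional R) c (restrTo R.set g)

theorem isAdditive_int (I : Integrator S) (g : S →ᵇ ℝ) :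
    RegOpen.IsAdditive fun R => I.int R g := fun a b h => by
  have h' := I.partition _ 2 _ (RegOpen.isRegPartition_pair h) g
  rwa [Fin.sum_univ_two] at h'

theorem restrTo_surjective (B : Set S) : Function.Surjective (restrTo B) := by
  rintro ⟨_, g, rfl⟩
  exact ⟨g, rfl⟩

theorem restrTo_apply (B : Set S) (g : S →ᵇ ℝ) (b : B) :
    (restrTo B g : B →ᵇ ℝ) b = g b := rfl

/-- `f` lies between the constants `±‖f‖`. -/
theorem abs_le_of_mono {B : Set S} (F : RestrSpace B →ₗ[ℝ] ℝ)
    (hF : ∀ f g : RestrSpace B, (∀ b, (f : B →ᵇ ℝ) b ≤ (g : B →ᵇ ℝ) b) → F f ≤ F g)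
    (f : RestrSpace B) : |F f| ≤ F (restrTo B 1) * ‖f‖ := by
  have h1 : ∀ c : ℝ, F (restrTo B (c • 1)) = c * F (restrTo B 1) := fun c =>
    map_smul F c (restrTo B 1)
  have hb : ∀ b, |(f : B →ᵇ ℝ) b| ≤ ‖f‖ := fun b => (f : B →ᵇ ℝ).norm_coe_le_norm b
  rw [abs_le, mul_comm, ← neg_mul, ← h1, ← h1]
  constructor
  · refine hF _ _ fun b => ?_
    rw [restrTo_apply]
    simpa using (abs_le.1 (hb b)).1
  · refine hF _ _ fun b => ?_
    rw [restrTo_apply]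
    simpa using (abs_le.1 (hb b)).2

theorem abs_functional_le (I : Integrator S) (R : RegOpen S) (f : RestrSpace R.set) :
    |I.functional R f| ≤ I.int R 1 * ‖f‖ :=
  abs_le_of_mono (I.functional R) (I.mono R) f

theorem int_zero (I : Integrator S) (R : RegOpen S) : I.int R 0 = 0 := by
  simpa using I.int_smul R 0 0

theorem int_one_nonneg (I : Integrator S) (R : RegOpen S) : 0 ≤ I.int R 1 := by
  rw [← I.int_zero R]
  exact I.int_mono R fun x _ => zero_le_one

theorem isCompatible_iff (I : Integrator S) (μ : Credence S) :
    I.IsCompatible μ ↔ ∀ R, I.int R 1 = μ.toFun R := by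
  refine forall_congr' fun R => ?_
  have h : IsLeast {C : ℝ | 0 ≤ C ∧ ∀ g : RestrSpace R.set, |I.functional R g| ≤ C * ‖g‖}
      (I.int R 1) := by
    refine ⟨⟨I.int_one_nonneg R, I.abs_functional_le R⟩, fun C hC => ?_⟩
    -- Only an inequality: the norm is 0 when `R` is empty.
    have h1 : ‖restrTo R.set (1 : S →ᵇ ℝ)‖ ≤ 1 :=
      (BoundedContinuousFunction.norm_le zero_le_one).2 fun b => by simp [restrTo_apply]
    calc I.int R 1 ≤ |I.functional R (restrTo R.set 1)| := le_abs_self _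
      _ ≤ C * ‖restrTo R.set (1 : S →ᵇ ℝ)‖ := hC.2 _
      _ ≤ C := mul_le_of_le_one_right hC.1 h1
  exact ⟨fun h' => h.unique h', fun h' => h' ▸ h⟩

theorem IsCompatible.integrates {I : Integrator S} {μ : Credence S} (h : I.IsCompatible μ)
    (g : S →ᵇ ℝ) : RegOpen.Integrates μ.toFun g fun R => I.int R g := by
  rw [isCompatible_iff] at h
  refine ⟨I.isAdditive_int g, fun R c ε hg => ?_⟩
  have h1 : I.int R g ≤ I.int R ((c + ε) • (1 : S →ᵇ ℝ)) := I.int_mono R fun x hx => by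
    simpa using by linarith [(abs_le.1 (hg x hx)).2]
  have h2 : I.int R ((c - ε) • (1 : S →ᵇ ℝ)) ≤ I.int R g := I.int_mono R fun x hx => by
    simpa using by linarith [(abs_le.1 (hg x hx)).1]
  rw [int_smul, h] at h1 h2
  rw [abs_le]
  constructor <;> linarith

theorem IsCompatible.unique {I I' : Integrator S} {μ : Credence S} (h : I.IsCompatible μ)
    (h' : I'.IsCompatible μ) : I = I' := by
  have key : I.functional = I'.functional := by
    funext R
    ext f
    obtain ⟨g, rfl⟩ := restrTo_surjective _ f
    exact (h.integrates g).unique μ.isAdditive (h'.integrates g) R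
  cases I
  cases I'
  congr

theorem exists_isCompatible (μ : Credence S) : ∃ I : Integrator S, I.IsCompatible μ := by
  obtain ⟨J, hadd, hone, hmono⟩ := μ.exists_integral
  -- Monotonicity on `R`, used both ways, shows that `J R` sees only the restriction to `R`; it
  -- therefore descends to the restriction space through any choice of extension.
  have hcongr : ∀ (R : RegOpen S) (f g : S →ᵇ ℝ), restrTo R.set f = restrTo R.set g →
      J R f = J R g := fun R f g h => by
    have h' : ∀ x ∈ R.set, f x = g x := fun x hx =>
      DFunLike.congr_fun (congrArg Subtype.val h) ⟨x, hx⟩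
    exact le_antisymm (hmono R f g fun x hx => (h' x hx).le)
      (hmono R g f fun x hx => (h' x hx).ge)
  let ext : ∀ R : RegOpen S, RestrSpace R.set → (S →ᵇ ℝ) := fun R =>
    Function.surjInv (restrTo_surjective R.set)
  have hext : ∀ R f, restrTo R.set (ext R f) = f := fun R =>
    Function.surjInv_eq (restrTo_surjective R.set)
  let F : ∀ R : RegOpen S, RestrSpace R.set →ₗ[ℝ] ℝ := fun R =>
    { toFun f := J R (ext R f)
      map_add' f g := by
        rw [← map_add]
        exact hcongr R _ _ (by rw [restrTo_add, hext, hext, hext])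
      map_smul' c g := by
        rw [RingHom.id_apply, ← map_smul]
        exact hcongr R _ _ (by rw [restrTo_smul, hext, hext]) }
  have hF : ∀ R g, F R (restrTo R.set g) = J R g := fun R g => hcongr R _ _ (hext R _)
  have hFmono : ∀ (R : RegOpen S) (f g : RestrSpace R.set),
      (∀ b, (f : R.set →ᵇ ℝ) b ≤ (g : R.set →ᵇ ℝ) b) → F R f ≤ F R g := fun R f g h => by
    obtain ⟨f, rfl⟩ := restrTo_surjective _ f
    obtain ⟨g, rfl⟩ := restrTo_surjective _ g
    rw [hF, hF]
    exact hmono R f g fun x hx => h ⟨x, hx⟩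
  let I : Integrator S :=
    { functional := F
      bounded R := ⟨_, abs_le_of_mono (F R) (hFmono R)⟩
      mono := hFmono
      partition R N B hB g := by
        simp only [hF]
        rw [← hB.2]
        exact (hadd g).map_finset_sup _ B fun i _ j _ hij => hB.1 hij }
  exact ⟨I, (I.isCompatible_iff μ).2 fun R => (hF R 1).trans (hone R)⟩

end Integrator

/-! ### Liminal densities -/

/-- The cells need only have dense union; finiteness puts every point in the closure of some cell.
-/
theorem RegOpen.exists_mem_of_notMem_frontier {X : Type*} [TopologicalSpace X] {N : ℕ}
    {B : Fin N → RegOpen X} (hB : IsRegPartition ⊤ B) {x : X}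
    (hx : ∀ n, x ∉ frontier (B n).set) : ∃ n, x ∈ (B n).set := by
  have h1 : x ∈ interior (closure (⋃ n, (B n).set)) := by
    rw [← RegOpen.set_finset_sup, hB.2]
    trivial
  have h2 := interior_subset h1
  rw [closure_iUnion_of_finite] at h2
  obtain ⟨n, hn⟩ := Set.mem_iUnion.1 h2
  refine ⟨n, ?_⟩
  by_contra h
  exact hx n ⟨hn, by rwa [(B n).isOpen_set.interior_eq]⟩

theorem RegOpen.notMem_of_mem_frontier {X : Type*} [TopologicalSpace X] {N : ℕ}
    {B : Fin N → RegOpen X} (hB : Pairwise fun i j => Disjoint (B i) (B j)) {x : X} {n : Fin N}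
    (hx : x ∈ frontier (B n).set) (i : Fin N) : x ∉ (B i).set := fun hi => by
  rcases eq_or_ne i n with rfl | hin
  · rw [(B i).isOpen_set.frontier_eq] at hx
    exact hx.2 hi
  · exact Set.disjoint_left.1 (RegOpen.disjoint_closure (hB hin)) hi hx.1

namespace LiminalDensity

variable {X : Type*} [TopologicalSpace X] [MeasurableSpace X] {ν : Measure X}
  (φ : LiminalDensity ν)

/-- The indicator of `R` completed by the density on the boundary of `R`. -/
noncomputable def weight (R : RegOpen X) (x : X) : ℝ :=
  R.set.indicator 1 x + (frontier R.set).indicator (φ.density R) x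

theorem weight_of_mem {R : RegOpen X} {x : X} (hx : x ∈ R.set) : φ.weight R x = 1 := by
  have h : x ∉ frontier R.set := by
    rw [R.isOpen_set.frontier_eq]
    exact fun h => h.2 hx
  simp [weight, hx, h]

theorem weight_of_mem_frontier {R : RegOpen X} {x : X} (hx : x ∈ frontier R.set) :
    φ.weight R x = φ.density R x := by
  have h : x ∉ R.set := by
    rw [R.isOpen_set.frontier_eq] at hx
    exact hx.2
  simp [weight, hx, h]

theorem weight_of_notMem_closure {R : RegOpen X} {x : X} (hx : x ∉ closure R.set) :
    φ.weight R x = 0 := by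
  have h1 : x ∉ frontier R.set := fun h => hx h.1
  have h2 : x ∉ R.set := fun h => hx (subset_closure h)
  simp [weight, h1, h2]

theorem weight_top (x : X) : φ.weight ⊤ x = 1 := φ.weight_of_mem (Set.mem_univ x)

variable [BorelSpace X]

theorem integrable_weight [IsFiniteMeasure ν] (R : RegOpen X) : Integrable (φ.weight R) ν :=
  ((integrable_const (1 : ℝ)).indicator R.isOpen_set.measurableSet).add
    ((integrable_indicator_iff isClosed_frontier.measurableSet).2 (φ.integrable R))

theorem weight_mem_Icc (R : RegOpen X) : ∀ᵐ x ∂ν, φ.weight R x ∈ Set.Icc (0 : ℝ) 1 := by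
  have h := φ.mem_Icc R
  rw [ae_restrict_iff' isClosed_frontier.measurableSet] at h
  filter_upwards [h] with x hx
  by_cases h1 : x ∈ frontier R.set
  · rw [φ.weight_of_mem_frontier h1]
    exact hx h1
  · rcases R.compl_frontier_subset h1 with h2 | h2
    · rw [φ.weight_of_mem h2]
      simp
    · rw [φ.weight_of_notMem_closure h2]
      simp

theorem sum_weight {N : ℕ} {B : Fin N → RegOpen X} (hB : IsRegPartition ⊤ B) :
    ∀ᵐ x ∂ν, ∑ n, φ.weight (B n) x = 1 := by
  have h := φ.partition N B hB
  rw [ae_restrict_iff' (MeasurableSet.iUnion fun n => isClosed_frontier.measurableSet)] at h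
  filter_upwards [h] with x hx
  by_cases h1 : x ∈ ⋃ n, frontier (B n).set
  · rw [← hx h1]
    obtain ⟨n, hn⟩ := Set.mem_iUnion.1 h1
    refine Finset.sum_congr rfl fun i _ => ?_
    simp [weight, RegOpen.notMem_of_mem_frontier hB.1 hn i]
  · simp only [Set.mem_iUnion, not_exists] at h1
    obtain ⟨n, hn⟩ := RegOpen.exists_mem_of_notMem_frontier hB h1
    rw [Finset.sum_eq_single n, φ.weight_of_mem hn]
    · intro i _ hi
      exact φ.weight_of_notMem_closure
        (Set.disjoint_left.1 (RegOpen.disjoint_closure (hB.1 hi.symm)) hn)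
    · simp

/-- The axiom for densities concerns partitions of the whole space only, so compare `{a, b, (a ⊔
b)ᶜ}` with `{a ⊔ b, (a ⊔ b)ᶜ}` and cancel. -/
theorem weight_sup {a b : RegOpen X} (h : Disjoint a b) :
    ∀ᵐ x ∂ν, φ.weight (a ⊔ b) x = φ.weight a x + φ.weight b x := by
  have h2 := RegOpen.isRegPartition_pair (disjoint_compl_right (a := a ⊔ b))
  rw [sup_compl_eq_top] at h2
  filter_upwards [φ.sum_weight (RegOpen.isRegPartition_triple h), φ.sum_weight h2] with x hx1 hx2
  simp only [Fin.sum_univ_succ] at hx1 hx2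
  simp at hx1 hx2
  linarith

theorem integrable_mul_weight [IsFiniteMeasure ν] [CompactSpace X] (f : C(X, ℝ))
    (R : RegOpen X) : Integrable (fun x => f x * φ.weight R x) ν :=
  (φ.integrable_weight R).bdd_mul (c := ‖f‖) f.continuous.measurable.aestronglyMeasurable
    (Filter.Eventually.of_forall f.norm_coe_le_norm)

theorem integral_mul_weight [IsFiniteMeasure ν] [CompactSpace X] (f : C(X, ℝ))
    (R : RegOpen X) : ∫ x, f x * φ.weight R x ∂ν =
      (∫ x in R.set, f x ∂ν) + ∫ x in frontier R.set, f x * φ.density R x ∂ν := by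
  have hf : Integrable f ν := by
    simpa [weight_top] using φ.integrable_mul_weight f ⊤
  have hφ : IntegrableOn (fun x => f x * φ.density R x) (frontier R.set) ν :=
    (φ.integrable R).bdd_mul (c := ‖f‖) f.continuous.measurable.aestronglyMeasurable
      (Filter.Eventually.of_forall f.norm_coe_le_norm)
  rw [← integral_indicator R.isOpen_set.measurableSet,
    ← integral_indicator isClosed_frontier.measurableSet,
    ← integral_add (hf.indicator R.isOpen_set.measurableSet)
      ((integrable_indicator_iff isClosed_frontier.measurableSet).2 hφ)]
  congr 1 with x
  by_cases h1 : x ∈ R.set <;> by_cases h2 : x ∈ frontier R.set <;> simp [weight, h1, h2, mul_add]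

theorem integral_weight [IsFiniteMeasure ν] [CompactSpace X] (R : RegOpen X) :
    ∫ x, φ.weight R x ∂ν = ν.real R.set + ∫ x in frontier R.set, φ.density R x ∂ν := by
  simpa using φ.integral_mul_weight 1 R

theorem isAdditive_integral_mul_weight [IsFiniteMeasure ν] [CompactSpace X] (f : C(X, ℝ)) :
    RegOpen.IsAdditive fun R => ∫ x, f x * φ.weight R x ∂ν := fun a b h => by
  rw [← integral_add (φ.integrable_mul_weight f a) (φ.integrable_mul_weight f b)]
  refine integral_congr_ae ?_
  filter_upwards [φ.weight_sup h] with x hx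
  rw [hx, mul_add]

theorem integrates [IsFiniteMeasure ν] [CompactSpace X] (f : C(X, ℝ)) :
    RegOpen.Integrates (fun R => ∫ x, φ.weight R x ∂ν) f
      fun R => ∫ x, f x * φ.weight R x ∂ν := by
  refine ⟨φ.isAdditive_integral_mul_weight f, fun R c ε h => ?_⟩
  -- The weight also charges the boundary, so the bound has to pass to the closure.
  have hcl : ∀ x ∈ closure R.set, |f x - c| ≤ ε := fun x hx =>
    closure_minimal (t := {x | |f x - c| ≤ ε}) h
      (isClosed_le (by fun_prop) continuous_const) hx
  have hi := φ.integrable_weight R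
  have hfi := φ.integrable_mul_weight f R
  rw [← integral_const_mul, ← integral_const_mul, ← integral_sub hfi (hi.const_mul c)]
  refine (abs_integral_le_integral_abs).trans
    (integral_mono_ae (hfi.sub (hi.const_mul c)).abs (hi.const_mul ε) ?_)
  filter_upwards [φ.weight_mem_Icc R] with x hx
  simp only [← sub_mul, abs_mul, abs_of_nonneg hx.1]
  by_cases hxc : x ∈ closure R.set
  · exact mul_le_mul_of_nonneg_right (hcl x hxc) hx.1
  · simp [φ.weight_of_notMem_closure hxc]

end LiminalDensity

/-! ### Normal measures and densities on compact spaces -/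

section Compact

variable {X : Type*} [TopologicalSpace X] [CompactSpace X] [T2Space X] [MeasurableSpace X]
  [BorelSpace X]

omit [T2Space X] in
theorem IsNormalMeasure.regular {ν : Measure X} [IsFiniteMeasure ν] (h : IsNormalMeasure ν) :
    ν.Regular where
  toOuterRegular := h.2
  innerRegular := fun U hU r hr => by
    obtain ⟨K, hKU, hK, hrK⟩ := h.1 hU.measurableSet r hr
    exact ⟨K, hKU, hK.isCompact, hrK⟩

omit [CompactSpace X] [BorelSpace X] in
theorem isNormalMeasure_of_regular (ν : Measure X) [IsFiniteMeasure ν] [ν.Regular] :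
    IsNormalMeasure ν :=
  ⟨fun _ hA => Measure.WeaklyRegular.innerRegular_measurable ⟨hA, measure_ne_top ν _⟩,
    inferInstance⟩

theorem MeasureTheory.Measure.ext_of_integral_continuousMap {ν ν' : Measure X} [ν.Regular]
    [ν'.Regular] (h : ∀ f : C(X, ℝ), ∫ x, f x ∂ν = ∫ x, f x ∂ν') : ν = ν' :=
  Measure.ext_of_integral_eq_on_compactlySupported fun f => h f

/-- The comparison `m + m' ≤ ν` on compact sets passes to `m ≤ ν` on open sets by inner regularity
of `m`, then to all measurable sets by outer regularity of `ν`. -/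
theorem MeasureTheory.Measure.le_of_integral_add_eq {ν m m' : Measure X}
    [IsFiniteMeasure ν] [IsFiniteMeasure m] [IsFiniteMeasure m'] [ν.Regular] [m.Regular]
    (h : ∀ f : C(X, ℝ), ∫ x, f x ∂m + ∫ x, f x ∂m' = ∫ x, f x ∂ν) : m ≤ ν := by
  have hK : ∀ K, IsCompact K → m K ≤ ν K := fun K hK => by
    have h1 : (m + m') K ≤ ν K := by
      refine RealRMK.measure_le_of_isCompact_of_integral (fun f => ?_) hK
      rw [integral_add_measure f.integrable f.integrable]
      exact (h f).le
    exact le_trans (by simp) h1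
  have hU : ∀ U, IsOpen U → m U ≤ ν U := fun U hU => by
    rw [hU.measure_eq_iSup_isCompact m]
    exact iSup₂_le fun K hKU => iSup_le fun hK' => (hK K hK').trans (measure_mono hKU)
  refine Measure.le_iff.2 fun A hA => ?_
  rw [A.measure_eq_iInf_isOpen ν]
  exact le_iInf₂ fun U hAU => le_iInf fun hU' => (measure_mono hAU).trans (hU U hU')

theorem exists_regular_integral_eq (Λ : C(X, ℝ) →ₗ[ℝ] ℝ) (hΛ : ∀ f, 0 ≤ f → 0 ≤ Λ f) :
    ∃ m : Measure X, IsFiniteMeasure m ∧ m.Regular ∧ ∀ f : C(X, ℝ), ∫ x, f x ∂m = Λ f := by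
  let Λ' : CompactlySupportedContinuousMap X ℝ →ₚ[ℝ] ℝ := PositiveLinearMap.mk₀
    { toFun f := Λ f
      map_add' f g := map_add Λ (f : C(X, ℝ)) g
      map_smul' c f := map_smul Λ c (f : C(X, ℝ)) } fun f hf => hΛ f hf
  exact ⟨RealRMK.rieszMeasure Λ', inferInstance, inferInstance, fun f =>
    RealRMK.integral_rieszMeasure Λ' (CompactlySupportedContinuousMap.continuousMapEquiv f)⟩

/-- For a continuous `g` close to `h` in L¹, `∫ h² = ∫ h (h - g) ≤ C ‖h - g‖₁`, so `∫ h² = 0`. -/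
theorem ae_eq_zero_of_integral_continuousMap_mul {ν : Measure X} [IsFiniteMeasure ν]
    [ν.WeaklyRegular] {h : X → ℝ} (hi : Integrable h ν) {C : ℝ} (hC : ∀ᵐ x ∂ν, |h x| ≤ C)
    (h0 : ∀ f : C(X, ℝ), ∫ x, f x * h x ∂ν = 0) : h =ᵐ[ν] 0 := by
  have hsq : Integrable (fun x => h x * h x) ν := hi.bdd_mul hi.1 hC
  have hle : ∫ x, h x * h x ∂ν ≤ 0 := by
    refine le_of_forall_pos_le_add fun ε hε => ?_
    obtain ⟨g, hg, hgi⟩ := hi.exists_boundedContinuous_integral_sub_le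
      (ε := ε / (|C| + 1)) (by positivity)
    have hgh : Integrable (fun x => g x * h x) ν :=
      hi.bdd_mul (c := ‖g‖) hgi.1 (Filter.Eventually.of_forall g.norm_coe_le_norm)
    have h1 : ∫ x, h x * h x ∂ν = ∫ x, (h x * h x - g x * h x) ∂ν := by
      have h2 : ∫ x, g x * h x ∂ν = 0 := h0 g.toContinuousMap
      rw [integral_sub hsq hgh, h2, sub_zero]
    have h2 : ∫ x, (h x * h x - g x * h x) ∂ν ≤ ∫ x, (|C| + 1) * ‖h x - g x‖ ∂ν := by
      refine integral_mono_ae (hsq.sub hgh) ((hi.sub hgi).norm.const_mul _) ?_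
      filter_upwards [hC] with x hx
      rw [← sub_mul, mul_comm, Real.norm_eq_abs]
      refine (le_abs_self _).trans ?_
      rw [abs_mul]
      exact mul_le_mul_of_nonneg_right (by linarith [le_abs_self C]) (abs_nonneg _)
    rw [integral_const_mul] at h2
    have h3 : (|C| + 1) * ∫ x, ‖h x - g x‖ ∂ν ≤ (|C| + 1) * (ε / (|C| + 1)) :=
      mul_le_mul_of_nonneg_left hg (by positivity)
    rw [mul_div_cancel₀ _ (by positivity)] at h3
    linarith
  have h4 := (integral_eq_zero_iff_of_nonneg (fun x => mul_self_nonneg (h x)) hsq).1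
    (le_antisymm hle (integral_nonneg fun x => mul_self_nonneg (h x)))
  filter_upwards [h4] with x hx
  exact mul_self_eq_zero.1 hx

end Compact

/-! ### Existence and uniqueness of the liminal representation -/

section Existence

variable {X : Type*} [TopologicalSpace X] [CompactSpace X] [T2Space X] [MeasurableSpace X]
  [BorelSpace X]

theorem measure_compl_closure_eq_zero {m : Measure X} [IsFiniteMeasure m] [m.Regular]
    {U : Set X} (h : ∀ f : C(X, ℝ), (∀ x ∈ U, f x = 0) → ∫ x, f x ∂m = 0) :
    m (closure U)ᶜ = 0 := by
  rw [isClosed_closure.isOpen_compl.measure_eq_iSup_isCompact m]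
  simp only [ENNReal.iSup_eq_zero]
  intro K hKU hK
  obtain ⟨f, hf1, -, hf2, hf3⟩ :=
    exists_continuousMap_one_of_isCompact_subset_isOpen hK isClosed_closure.isOpen_compl hKU
  have h0 : ∫ x, f x ∂m = 0 := h f fun x hx => by
    by_contra hfx
    exact hf2 (subset_tsupport f hfx) (subset_closure hx)
  have hfi : Integrable f m :=
    (CompactlySupportedContinuousMap.continuousMapEquiv f).integrable
  have h1 := (integral_eq_zero_iff_of_nonneg (fun x => (hf3 x).1) hfi).1 h0
  refine measure_mono_null (fun x hx => ?_) h1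
  have : f x = 1 := hf1 hx
  simp [this]

/-- A positive-functional-valued additive function on regular open sets, with `Λ R` carried by
`R`, is represented by a measure and a liminal density structure. -/
theorem exists_liminalDensity (Λ : RegOpen X → C(X, ℝ) →ₗ[ℝ] ℝ)
    (hadd : ∀ f, RegOpen.IsAdditive fun R => Λ R f)
    (hmono : ∀ R f g, (∀ x ∈ R.set, f x ≤ g x) → Λ R f ≤ Λ R g) :
    ∃ (ν : Measure X) (φ : LiminalDensity ν), IsFiniteMeasure ν ∧ ν.Regular ∧
      ∀ R f, ∫ x, f x * φ.weight R x ∂ν = Λ R f := by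
  have hpos : ∀ R f, 0 ≤ f → 0 ≤ Λ R f := fun R f hf => by
    rw [← map_zero (Λ R)]
    exact hmono R 0 f fun x _ => hf x
  choose m hfin hreg hm using fun R => exists_regular_integral_eq (Λ R) (hpos R)
  have hle : ∀ R, m R ≤ m ⊤ := fun R =>
    Measure.le_of_integral_add_eq (m' := m Rᶜ) fun f => by
      rw [hm, hm, hm, ← sup_compl_eq_top (x := R)]
      exact (hadd f R Rᶜ disjoint_compl_right).symm
  have hac : ∀ R, m R ≪ m ⊤ := fun R => Measure.absolutelyContinuous_of_le (hle R)
  let d : RegOpen X → X → ℝ := fun R x => ((m R).rnDeriv (m ⊤) x).toReal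
  have hd : ∀ R (f : C(X, ℝ)), ∫ x, f x * d R x ∂(m ⊤) = Λ R f := fun R f => by
    simp only [d, mul_comm (f _)]
    exact (integral_rnDeriv_smul (hac R)).trans (hm R f)
  have hdi : ∀ R, Integrable (d R) (m ⊤) := fun R => Measure.integrable_toReal_rnDeriv
  have hdI : ∀ R, ∀ᵐ x ∂(m ⊤), d R x ∈ Set.Icc (0 : ℝ) 1 := fun R => by
    filter_upwards [Measure.rnDeriv_le_one_of_le (hle R)] with x hx
    exact ⟨ENNReal.toReal_nonneg, ENNReal.toReal_le_of_le_ofReal zero_le_one (by simpa using hx)⟩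
  have hfd : ∀ R (f : C(X, ℝ)), Integrable (fun x => f x * d R x) (m ⊤) := fun R f =>
    (hdi R).bdd_mul (c := ‖f‖) f.continuous.measurable.aestronglyMeasurable
      (Filter.Eventually.of_forall f.norm_coe_le_norm)
  have hd0 : ∀ R, ∀ᵐ x ∂(m ⊤), x ∉ closure R.set → d R x = 0 := fun R => by
    have hO : MeasurableSet (closure R.set)ᶜ := isClosed_closure.measurableSet.compl
    have h1 : m R (closure R.set)ᶜ = 0 := measure_compl_closure_eq_zero fun f hf => by
      rw [hm, ← map_zero (Λ R)]
      exact le_antisymm (hmono R f 0 fun x hx => (hf x hx).le)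
        (hmono R 0 f fun x hx => (hf x hx).ge)
    rw [← Measure.setLIntegral_rnDeriv (hac R),
      lintegral_eq_zero_iff (Measure.measurable_rnDeriv _ _), Filter.EventuallyEq,
      ae_restrict_iff' hO] at h1
    filter_upwards [h1] with x hx hxc
    simp [d, hx hxc]
  have hsum : ∀ (N : ℕ) (B : Fin N → RegOpen X), IsRegPartition ⊤ B →
      ∀ᵐ x ∂(m ⊤), ∑ n, d (B n) x = 1 := fun N B hB => by
    -- Additivity of `Λ` makes this difference orthogonal to all continuous functions, and `d ⊤ = 1`
    -- almost everywhere.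
    have h1 : (fun x => ∑ n, d (B n) x - d ⊤ x) =ᵐ[m ⊤] 0 := by
      refine ae_eq_zero_of_integral_continuousMap_mul (C := N + 1)
        ((integrable_finsetSum _ fun n _ => hdi (B n)).sub (hdi ⊤)) ?_ fun f => ?_
      · filter_upwards [Filter.eventually_all.2 fun n => hdI (B n), hdI ⊤] with x hx hx'
        have h2 : ∑ n, d (B n) x ≤ ∑ n : Fin N, (1 : ℝ) := Finset.sum_le_sum fun n _ => (hx n).2
        have h3 : 0 ≤ ∑ n, d (B n) x := Finset.sum_nonneg fun n _ => (hx n).1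
        simp only [Finset.sum_const, Finset.card_univ, Fintype.card_fin, nsmul_eq_mul,
          mul_one] at h2
        rw [abs_le]
        constructor <;> linarith [hx'.1, hx'.2]
      · have h2 : Λ ⊤ f = ∑ n, Λ (B n) f := by
          rw [← hB.2]
          exact (hadd f).map_finset_sup _ B fun i _ j _ hij => hB.1 hij
        simp only [mul_sub, Finset.mul_sum]
        rw [integral_sub (integrable_finsetSum _ fun n _ => hfd (B n) f) (hfd ⊤ f),
          integral_finsetSum _ fun n _ => hfd (B n) f]
        simp only [hd, h2, sub_self]
    filter_upwards [h1, Measure.rnDeriv_self (m ⊤)] with x hx hx'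
    have h2 : d ⊤ x = 1 := by simp [d, hx']
    simp only [Pi.zero_apply, h2] at hx
    linarith
  have hd1 : ∀ R, ∀ᵐ x ∂(m ⊤), x ∈ R.set → d R x = 1 := fun R => by
    have h2 := RegOpen.isRegPartition_pair (disjoint_compl_right (a := R))
    rw [sup_compl_eq_top] at h2
    -- The closure of `Rᶜ` is the set complement of `R`, so the density of `Rᶜ` vanishes on `R`.
    filter_upwards [hsum 2 _ h2, hd0 Rᶜ] with x hx hx' hxR
    rw [Fin.sum_univ_two] at hx
    have h3 := hx' (by rw [RegOpen.closure_set_compl]; exact fun h => h hxR)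
    simp only [Matrix.cons_val_zero, Matrix.cons_val_one, h3, add_zero] at hx
    exact hx
  let φ : LiminalDensity (m ⊤) :=
    { density := d
      integrable R := (hdi R).integrableOn
      mem_Icc R := ae_restrict_of_ae (hdI R)
      partition N B hB := by
        rw [ae_restrict_iff' (MeasurableSet.iUnion fun n => isClosed_frontier.measurableSet)]
        filter_upwards [hsum N B hB, Filter.eventually_all.2 fun n => hd0 (B n)] with x h1 h2 hx
        obtain ⟨n, hn⟩ := Set.mem_iUnion.1 hx
        rw [← h1]
        refine Finset.sum_congr rfl fun i _ => ?_
        by_cases hi : x ∈ frontier (B i).set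
        · simp [hi]
        · rw [Set.indicator_of_notMem hi]
          exact (h2 i (((B i).compl_frontier_subset hi).resolve_left
            (RegOpen.notMem_of_mem_frontier hB.1 hn i))).symm }
  refine ⟨m ⊤, φ, inferInstance, inferInstance, fun R f => ?_⟩
  rw [← hd R f]
  refine integral_congr_ae ?_
  filter_upwards [hd0 R, hd1 R] with x h0 h1
  congr 1
  by_cases hx : x ∈ frontier R.set
  · exact φ.weight_of_mem_frontier hx
  · rcases R.compl_frontier_subset hx with h | h
    · rw [φ.weight_of_mem h, h1 h]
    · rw [φ.weight_of_notMem_closure h, h0 h]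

/-- A regular measure and a liminal density structure are determined by the masses they assign
to regular open sets. -/
theorem LiminalDensity.unique {ν ν' : Measure X} [IsFiniteMeasure ν] [IsFiniteMeasure ν']
    [ν.Regular] [ν'.Regular] (φ : LiminalDensity ν) (φ' : LiminalDensity ν')
    (h : ∀ R, ∫ x, φ'.weight R x ∂ν' = ∫ x, φ.weight R x ∂ν) :
    ν' = ν ∧ ∀ R : RegOpen X, φ'.density R =ᵐ[ν.restrict (frontier R.set)] φ.density R := by
  have key : ∀ (f : C(X, ℝ)) R,
      ∫ x, f x * φ'.weight R x ∂ν' = ∫ x, f x * φ.weight R x ∂ν := fun f R => by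
    have hm : RegOpen.IsAdditive fun R => ∫ x, φ.weight R x ∂ν := by
      simpa using φ.isAdditive_integral_mul_weight 1
    have h1 := φ'.integrates f
    -- Both families now integrate `f` against the same mass function, so they agree.
    simp only [h] at h1
    exact RegOpen.Integrates.unique (g := BoundedContinuousFunction.mkOfCompact f) hm h1
      (φ.integrates f) R
  have hν : ν' = ν := Measure.ext_of_integral_continuousMap fun f => by
    simpa [weight_top] using key f ⊤
  subst hν
  refine ⟨rfl, fun R => ?_⟩
  have h1 : (fun x => φ'.weight R x - φ.weight R x) =ᵐ[ν'] 0 := by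
    refine ae_eq_zero_of_integral_continuousMap_mul (C := 1)
      ((φ'.integrable_weight R).sub (φ.integrable_weight R)) ?_ fun f => ?_
    · filter_upwards [φ'.weight_mem_Icc R, φ.weight_mem_Icc R] with x hx' hx
      rw [abs_le]
      constructor <;> linarith [hx'.1, hx'.2, hx.1, hx.2]
    · simp only [mul_sub]
      rw [integral_sub (φ'.integrable_mul_weight f R) (φ.integrable_mul_weight f R), key,
        sub_self]
  rw [Filter.EventuallyEq, ae_restrict_iff' isClosed_frontier.measurableSet]
  filter_upwards [h1] with x hx hxR
  rw [← φ'.weight_of_mem_frontier hxR, ← φ.weight_of_mem_frontier hxR]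
  exact sub_eq_zero.1 hx

end Existence

/-! ### Transfer to the compactification -/

theorem mainTheorem4 {S Sbar : Type*} [TopologicalSpace S] [T2Space S] [LocallyCompactSpace S]
    [TopologicalSpace Sbar] [CompactSpace Sbar] [T2Space Sbar]
    [MeasurableSpace Sbar] [BorelSpace Sbar]
    (ι : S → Sbar) (hι : IsDenseEmbedding ι) (μ : Credence S) :
    -- "the" compatible integrator and "the" extension of a regular open set are well defined
    (∃! I : Integrator S, I.IsCompatible μ) ∧
    (∀ R : RegOpen S, ∃! Rbar : RegOpen Sbar, IsRegExtension ι R Rbar) ∧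
    ∃ (ν : Measure Sbar) (φ : LiminalDensity ν),
      IsProbabilityMeasure ν ∧ IsNormalMeasure ν ∧
      -- representation of the credence
      Represents ι ν φ μ ∧
      -- uniqueness of the measure and (almost everywhere) of the liminal density structure
      (∀ (ν' : Measure Sbar) (φ' : LiminalDensity ν'),
        IsNormalMeasure ν' → Represents ι ν' φ' μ →
          ν' = ν ∧
          ∀ Rbar : RegOpen Sbar,
            φ'.density Rbar =ᵐ[ν.restrict (frontier Rbar.set)] φ.density Rbar) ∧
      -- representation of the integrator on functions extending continuously to `Sbar`
      (∀ I : Integrator S, I.IsCompatible μ →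
        ∀ (R : RegOpen S) (Rbar : RegOpen Sbar), IsRegExtension ι R Rbar →
          ∀ (f : S →ᵇ ℝ) (fbar : C(Sbar, ℝ)), (∀ s, fbar (ι s) = f s) →
            I.int R f = (∫ x in Rbar.set, fbar x ∂ν) +
              ∫ x in frontier Rbar.set, fbar x * φ.density Rbar x ∂ν) := by
  obtain ⟨I, hI⟩ := Integrator.exists_isCompatible μ
  have hI1 := (I.isCompatible_iff μ).1 hI
  let r : C(Sbar, ℝ) → (S →ᵇ ℝ) := fun f =>
    (BoundedContinuousFunction.mkOfCompact f).compContinuous ⟨ι, hι.continuous⟩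
  let Λ : RegOpen Sbar → C(Sbar, ℝ) →ₗ[ℝ] ℝ := fun R =>
    { toFun f := I.int (RegOpen.trace hι R) (r f)
      map_add' f g := I.int_add _ (r f) (r g)
      map_smul' c f := I.int_smul _ c (r f) }
  obtain ⟨ν, φ, hfin, hreg, hΛ⟩ := exists_liminalDensity Λ
    (fun f => (I.isAdditive_int (r f)).comp_trace hι)
    (fun R f g h => I.int_mono _ fun s hs => h (ι s) hs)
  have hmass : ∀ R : RegOpen Sbar,
      ∫ x, φ.weight R x ∂ν = μ.toFun (RegOpen.trace hι R) := fun R => by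
    have h : Λ R 1 = μ.toFun (RegOpen.trace hι R) := hI1 _
    simpa [h] using hΛ R 1
  have hext : ∀ R : RegOpen Sbar, IsRegExtension ι (RegOpen.trace hι R) R := fun R => rfl
  refine ⟨⟨I, hI, fun I' hI' => hI'.unique hI⟩, RegOpen.existsUnique_isRegExtension hι,
    ν, φ, ⟨?_⟩, isNormalMeasure_of_regular ν, ?_, ?_, ?_⟩
  · have h := hmass ⊤
    rw [RegOpen.trace_top, μ.top_eq] at h
    simpa [LiminalDensity.weight_top, Measure.real, ENNReal.toReal_eq_one_iff] using h
  · intro R Rbar hR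
    rw [← (RegOpen.isRegExtension_iff hι).1 hR, ← hmass, φ.integral_weight]
  · intro ν' φ' hν' hrep
    -- Finiteness of `ν'` is not given. The boundary of `⊤` is empty, so `ν'.real` of the whole
    -- space is 1, which excludes infinite mass since `toReal` sends `∞` to 0.
    have h1 := hrep ⊤ ⊤ rfl
    rw [μ.top_eq, RegOpen.set_top, frontier_univ, setIntegral_empty, add_zero, Measure.real,
      eq_comm, ENNReal.toReal_eq_one_iff] at h1
    have : IsProbabilityMeasure ν' := ⟨h1⟩
    have := hν'.regular
    refine φ.unique φ' fun R => ?_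
    rw [φ'.integral_weight, hmass]
    exact (hrep _ _ (hext R)).symm
  · intro I' hI' R Rbar hR f fbar hf
    obtain rfl := hI'.unique hI
    rw [← φ.integral_mul_weight, hΛ, ← (RegOpen.isRegExtension_iff hι).1 hR]
    congr 1
    ext s
    exact (hf s).symm
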